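/- Let $\mathcal H$ be a complex Hilbert space, let $\mathcal K=\mathcal K(\mathcal H)$ be the $C^*$-algebra of all compact operators on $\mathcal H$, and let $E$ be a (left) Hilbert $\mathcal K$-module, with $\mathcal K$-valued inner product $\langle\cdot,\cdot\rangle$ that is $\mathcal K$-linear in the first variable. Let $B(E)$ be the $C^*$-algebra of adjointable operators on $E$, i.e. of all maps $T:E\to E$ for which there is $T^*:E\to E$ with $\langle Tx,y\rangle=\langle x,T^*y\rangle$ for all $x,y\in E$, and let $K(E)$ be the norm closure of the linear span of the operators $\Theta_{x,y}:z\mapsto\langle z,x\rangle y$, $x,y\in E$. An operator $T\in B(E)$ is called Fredholm if there are $S_1,S_2\in B(E)$ with $S_1T-1\in K(E)$ and $TS_2-1\in K(E)$. A minimal projection of $\mathcal K$ is a nonzero projection $e$ with $e\mathcal Ke=\mathbb Ce$. An orthonormal basis of a closed submodule $X\subseteq E$ is a family $(x_\lambda)$ in $X$ such that every $\langle x_\lambda,x_\lambda\rangle$ is a minimal projection of $\mathcal K$, $\langle x_\lambda,x_\mu\rangle=0$ for $\lambda\ne\mu$, and the submodule generated by $(x_\lambda)$ is dense in $X$; the orthonormal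 dimension $\dim_{\mathcal K}X$ is the common cardinality of all orthonormal bases of $X$. Theorem. Let $T\in B(E)$. Then $T$ is Fredholm if and only if the range $\operatorname{Ran}T$ is closed in $E$ and both $\dim_{\mathcal K}\operatorname{Ker}T$ and $\dim_{\mathcal K}\operatorname{Ker}T^*$ are finite. -/

import Mathlib

open scoped InnerProductSpace

/-! ### The C⋆-algebra of compact operators on a Hilbert space -/

section CompactAlgebra

variable (H : Type*) [NormedAddCommGroup H] [InnerProductSpace ℂ H] [CompleteSpace H]

variable {H} in
/-- The Hilbert space adjoint of a compact operator is compact. -/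
theorem isCompactOperator_star {T : H →L[ℂ] H} (hT : IsCompactOperator T) :
    IsCompactOperator (star T : H →L[ℂ] H) := by
  have hS : IsCompactOperator (T * star T : H →L[ℂ] H) := hT.comp_clm (star T)
  have hSt : TotallyBounded ((T * star T : H →L[ℂ] H) '' Metric.closedBall 0 1) :=
    (hS.isCompact_closure_image_closedBall
      (f := ((T * star T : H →L[ℂ] H) : H →ₗ[ℂ] H)) 1).totallyBounded.subset subset_closure
  have key : TotallyBounded ((star T : H →L[ℂ] H) '' Metric.closedBall 0 1) := by
    rw [Metric.totallyBounded_iff]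
    intro ε hε
    obtain ⟨t, hts, htf, htc⟩ :=
      Metric.finite_approx_of_totallyBounded hSt (ε ^ 2 / 2) (by positivity)
    obtain ⟨u, huB, huf, rfl⟩ := (Set.exists_subset_image_finite_and
      (p := fun s => s = t)).1 ⟨t, hts, htf, rfl⟩
    refine ⟨(star T : H →L[ℂ] H) '' u, huf.image _, ?_⟩
    rintro _ ⟨x, hx, rfl⟩
    have h1 := htc ⟨x, hx, rfl⟩
    simp only [Set.mem_iUnion, Metric.mem_ball, exists_prop, Set.mem_image,
      exists_exists_and_eq_and] at h1 ⊢
    obtain ⟨y, hy, hxy⟩ := h1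
    refine ⟨y, hy, ?_⟩
    have hyB := huB hy
    rw [mem_closedBall_zero_iff] at hx hyB
    rw [dist_eq_norm, ← map_sub] at hxy ⊢
    have h2 : ‖x - y‖ ≤ 2 := (norm_sub_le _ _).trans (by linarith)
    have h3 : ‖(star T : H →L[ℂ] H) (x - y)‖ ^ 2 ≤
        ‖(T * star T : H →L[ℂ] H) (x - y)‖ * ‖x - y‖ := by
      have h4 : (‖(star T : H →L[ℂ] H) (x - y)‖ ^ 2 : ℝ) =
          RCLike.re ⟪(T * star T : H →L[ℂ] H) (x - y), x - y⟫_ℂ := by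
        rw [← inner_self_eq_norm_sq (𝕜 := ℂ)]
        congr 1
        rw [ContinuousLinearMap.star_eq_adjoint, ContinuousLinearMap.adjoint_inner_right]
        rfl
      rw [h4]
      exact (RCLike.re_le_norm _).trans (norm_inner_le_norm _ _)
    refine lt_of_pow_lt_pow_left₀ 2 hε.le (h3.trans_lt ?_)
    nlinarith [norm_nonneg ((T * star T : H →L[ℂ] H) (x - y)), norm_nonneg (x - y)]
  refine (isCompactOperator_iff_isCompact_closure_image_closedBall
    ((star T : H →L[ℂ] H) : H →ₗ[ℂ] H) one_pos).2 ?_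
  exact key.closure.isCompact_of_isClosed isClosed_closure

/-- `𝒦(H)`: the compact operators on the Hilbert space `H`, as a (non-unital) star subalgebra of
the bounded operators. Norm, star and (Loewner) order are those of `H →L[ℂ] H`. -/
def compactAlgebra : NonUnitalStarSubalgebra ℂ (H →L[ℂ] H) where
  carrier := {T | IsCompactOperator T}
  add_mem' hS hT := hS.add hT
  zero_mem' := isCompactOperator_zero
  smul_mem' c _ hT := hT.smul c
  mul_mem' {_ T} hS _ := hS.comp_clm T
  star_mem' hT := isCompactOperator_star hT

instance compactAlgebra.isClosed : IsClosed (compactAlgebra H : Set (H →L[ℂ] H)) :=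
  isClosed_setOfPred_isCompactOperator

/-- An element of `𝒦(H)` is positive as an operator iff it is positive in the C⋆-algebra
`𝒦(H)`. -/
instance compactAlgebra.instStarOrderedRing : StarOrderedRing (compactAlgebra H) := by
  refine StarOrderedRing.of_nonneg_iff' (fun {x y} h z => ?_) (fun x => ⟨fun h => ?_, ?_⟩)
  · exact add_le_add_right (α := H →L[ℂ] H) h z
  · have h' : (0 : H →L[ℂ] H) ≤ (x : H →L[ℂ] H) := h
    have hm : CFC.sqrt (x : H →L[ℂ] H) ∈ compactAlgebra H := by
      rw [CFC.sqrt_eq_real_sqrt _ h']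
      exact NonUnitalStarAlgebra.elemental.le_of_mem (R := ℝ)
        (s := { compactAlgebra H with
          smul_mem' := fun c y hy => by
            rw [← Complex.coe_smul]
            exact (compactAlgebra H).smul_mem (c : ℂ) hy }) (compactAlgebra.isClosed H) x.2
        (cfcₙ_mem_elemental _ _)
    refine ⟨⟨_, hm⟩, Subtype.ext ?_⟩
    change (x : H →L[ℂ] H) = star (CFC.sqrt (x : H →L[ℂ] H)) * CFC.sqrt (x : H →L[ℂ] H)
    rw [(CFC.sqrt_nonneg (x : H →L[ℂ] H)).isSelfAdjoint.star_eq, CFC.sqrt_mul_sqrt_self _ h']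
  · rintro ⟨s, rfl⟩
    exact star_mul_self_nonneg (s : H →L[ℂ] H)

end CompactAlgebra

/-! ### Operators on Hilbert C⋆-modules

Mathlib's `CStarModule A E` is a left `A`-module with an `A`-valued inner product that is
`A`-linear in the *second* variable, so `inner A x y` is `⟨y, x⟩` in the convention where the inner
product is linear in the first variable. -/

section Module

variable (A E : Type*) [NonUnitalCStarAlgebra A] [PartialOrder A]
  [NormedAddCommGroup E] [NormedSpace ℂ E] [SMul A E] [CStarModule A E]

/-- `B(E)`: maps `T : E → E` that have an adjoint. -/
structure AdjointableOp where
  toFun : E → E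
  exists_adjoint : ∃ S : E → E, ∀ x y : E, inner A (toFun x) y = inner A x (S y)

variable {A E}

namespace AdjointableOp

instance : CoeFun (AdjointableOp A E) fun _ => E → E := ⟨toFun⟩

/-- The adjoint `T⋆`. -/
noncomputable def adjoint (T : AdjointableOp A E) : AdjointableOp A E where
  toFun := T.exists_adjoint.choose
  exists_adjoint := ⟨T, fun x y => by
    have h := congrArg star (T.exists_adjoint.choose_spec y x)
    rw [CStarModule.star_inner, CStarModule.star_inner] at h
    exact h.symm⟩

theorem inner_adjoint (T : AdjointableOp A E) (x y : E) :
    inner A (T x) y = inner A x (T.adjoint y) :=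
  T.exists_adjoint.choose_spec x y

theorem inner_ext {x y : E} (h : ∀ z : E, inner A x z = inner A y z) : x = y := by
  rw [← sub_eq_zero, ← CStarModule.inner_self (A := A), CStarModule.inner_sub_left, h, sub_self]

/-- Adjointable maps are linear. -/
noncomputable def toLinearMap (T : AdjointableOp A E) : E →ₗ[ℂ] E where
  toFun := T
  map_add' x y := inner_ext (A := A) fun z => by
    rw [CStarModule.inner_add_left, T.inner_adjoint, T.inner_adjoint, T.inner_adjoint,
      CStarModule.inner_add_left]
  map_smul' c x := inner_ext (A := A) fun z => by
    rw [RingHom.id_apply, CStarModule.inner_smul_left_complex, T.inner_adjoint, T.inner_adjoint,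
      CStarModule.inner_smul_left_complex]

variable [StarOrderedRing A]

/-- Adjointable maps are bounded linear operators. -/
noncomputable def toCLM [CompleteSpace E] (T : AdjointableOp A E) : E →L[ℂ] E where
  toLinearMap := T.toLinearMap
  cont := by
    refine T.toLinearMap.continuous_of_seq_closed_graph fun u x y hu hTu => ?_
    refine inner_ext (A := A) fun z => ?_
    have hc : ∀ w : E, Continuous fun v : E => inner A v w := fun w =>
      (CStarModule.continuous_inner (A := A) (E := E)).comp (continuous_id.prodMk continuous_const)
    refine tendsto_nhds_unique (((hc z).tendsto y).comp hTu) ?_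
    have h := ((hc (T.adjoint z)).tendsto x).comp hu
    rw [show inner A (T.toLinearMap x) z = inner A x (T.adjoint z) from T.inner_adjoint x z]
    exact h.congr fun n => (T.inner_adjoint (u n) z).symm

/-- The elementary operator `Θ_{x,y}(z) = ⟨z, x⟩ y` (inner product linear in the first variable),
with adjoint `Θ_{y,x}`. -/
def theta (x y : E) : AdjointableOp A E where
  toFun z := inner A x z • y
  exists_adjoint := ⟨fun w => inner A y w • x, fun z w => by
    rw [CStarModule.inner_op_smul_left, CStarModule.inner_op_smul_right, CStarModule.star_inner]⟩

end AdjointableOp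

variable [StarOrderedRing A]

variable (A E) in
/-- `K(E)`: the operator-norm closure of the linear span of the operators `Θ_{x,y}`. -/
noncomputable def moduleCompacts [CompleteSpace E] : Submodule ℂ (E →L[ℂ] E) :=
  (Submodule.span ℂ
    (Set.range fun p : E × E => (AdjointableOp.theta (A := A) p.1 p.2).toCLM)).topologicalClosure

/-- `T ∈ B(E)` is Fredholm: it has a left and a right inverse in `B(E)` modulo `K(E)`. -/
def AdjointableOp.IsFredholm [CompleteSpace E] (T : AdjointableOp A E) : Prop :=
  (∃ S : AdjointableOp A E, S.toCLM ∘L T.toCLM - ContinuousLinearMap.id ℂ E ∈ moduleCompacts A E) ∧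
  (∃ S : AdjointableOp A E, T.toCLM ∘L S.toCLM - ContinuousLinearMap.id ℂ E ∈ moduleCompacts A E)

/-! ### Orthonormal bases and orthonormal dimension -/

/-- A minimal projection of a C⋆-algebra: a nonzero projection `e` with `e A e = ℂ e`. -/
def IsMinimalProjection (e : A) : Prop :=
  IsStarProjection e ∧ e ≠ 0 ∧ ∀ a : A, ∃ c : ℂ, e * a * e = c • e

variable (A) in
/-- Orthonormal system: each `⟨x, x⟩` is a minimal projection and distinct members are
orthogonal. (Members are nonzero, so a system is the same as the set of its members.) -/
def IsOrthonormalSystem (S : Set E) : Prop :=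
  (∀ x ∈ S, IsMinimalProjection (inner A x x)) ∧ S.Pairwise fun x y => inner A x y = 0

variable (A) in
/-- The `A`-submodule of `E` generated by `S`. -/
def generatedSubmodule (S : Set E) : Submodule ℂ E :=
  Submodule.span ℂ (S ∪ {y | ∃ a : A, ∃ x ∈ S, y = a • x})

variable (A) in
/-- `S` is an orthonormal basis of the submodule `X`: an orthonormal system in `X` that generates a
dense submodule of `X`. -/
def IsOrthonormalBasisOf (X : Submodule ℂ E) (S : Set E) : Prop :=
  S ⊆ X ∧ IsOrthonormalSystem A S ∧ (X : Set E) ⊆ closure (generatedSubmodule A S : Set E)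

variable (A) in
/-- The orthonormal dimension of the submodule `X`: the cardinality of its orthonormal bases, with
value `⊤` when it is infinite. (All orthonormal bases have the same cardinality; were there no
basis at all, the value would be `⊤`.) -/
noncomputable def orthonormalDim (X : Submodule ℂ E) : ℕ∞ :=
  ⨅ (S : Set E) (_ : IsOrthonormalBasisOf A X S), S.encard

end Module

/-! ### Closed range and lower bounds for bounded operators. -/

section BoundedBelow

variable {W E : Type*} [NormedAddCommGroup W] [NormedSpace ℂ W]
  [NormedAddCommGroup E] [NormedSpace ℂ E]

namespace ContinuousLinearMap

/-! Fix a unit vector ξ and put e = `rk ξ ξ`. Since e𝒦e = ℂe, the corner eE is a Hilbert space, and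
adjointable operators preserve it. It determines E: `rk η η • x` comes from the corner vector `rk ξ
η • x`, and x is a limit of combinations of such cut-downs (`mem_closure_span_rk_smul`).

If T is Fredholm, elements of K(E) are limits of operators of finite rank on eE, so a left
parametrix gives R T = 1 + F with F of finite rank there. Thus Ker T ∩ eE is finite-dimensional, its
Hilbert basis is a module basis of Ker T, and T is bounded below on eE off the kernel.
`norm_le_of_norm_rk_smul_le` carries this bound to E. The adjoint of a right parametrix handles T⋆.

Conversely, finite bases give projections P, Q in K(E) onto Ker T and Ker T⋆. Closed range makes T⋆T
+ P bounded below; its range is closed with zero orthogonal complement, hence everything, by Hilbert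
space theory in eE. Then R = (T⋆T + P)⁻¹T⋆ satisfies RT = 1 - P and TR = 1 - Q. -/

theorem isClosed_range_of_norm_le [CompleteSpace W] (f : W →L[ℂ] E) {C : ℝ}
    (h : ∀ x, ‖x‖ ≤ C * ‖f x‖) : IsClosed (Set.range f) := by
  have hf : AntilipschitzWith C.toNNReal f := AddMonoidHomClass.antilipschitz_of_bound f fun x =>
    (h x).trans (by gcongr; exact Real.le_coe_toNNReal C)
  exact hf.isClosed_range f.uniformContinuous

/-- The hypotheses make p an idempotent onto ker f, so x - p x lies in ker p and has the same image
as x. -/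
theorem range_comp_subtypeL_ker {f : W →L[ℂ] E} {p : W →L[ℂ] W} (hfp : ∀ x, f (p x) = 0)
    (hid : ∀ x, f x = 0 → p x = x) : Set.range (f ∘L p.ker.subtypeL) = Set.range f := by
  refine Set.Subset.antisymm ?_ ?_
  · rintro _ ⟨x, rfl⟩
    exact ⟨x, rfl⟩
  · rintro _ ⟨x, rfl⟩
    refine ⟨⟨x - p x, ?_⟩, ?_⟩
    · rw [LinearMap.mem_ker, coe_coe, map_sub, hid _ (hfp x), sub_self]
    · change f (x - p x) = f x
      rw [map_sub, hfp, sub_zero]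

/-- An operator with closed range is bounded below off its kernel. -/
theorem exists_norm_sub_le_of_isClosed_range [CompleteSpace W] [CompleteSpace E]
    {f : W →L[ℂ] E} {p : W →L[ℂ] W} (hfp : ∀ x, f (p x) = 0) (hid : ∀ x, f x = 0 → p x = x)
    (hf : IsClosed (Set.range f)) : ∃ C : ℝ, 0 ≤ C ∧ ∀ x, ‖x - p x‖ ≤ C * ‖f x‖ := by
  have : CompleteSpace p.ker := p.isClosed_ker.completeSpace_coe
  have hinj : Function.Injective (f ∘L p.ker.subtypeL) := by
    refine (injective_iff_map_eq_zero _).2 fun x hx => Subtype.ext ?_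
    exact (hid _ hx).symm.trans x.2
  obtain ⟨K, hK⟩ := (f ∘L p.ker.subtypeL).antilipschitz_of_injective_of_isClosed_range hinj
    (range_comp_subtypeL_ker hfp hid ▸ hf)
  refine ⟨K, K.2, fun x => ?_⟩
  have hsub : x - p x ∈ p.ker := by
    rw [LinearMap.mem_ker, coe_coe, map_sub, hid _ (hfp x), sub_self]
  have := hK.le_mul_dist ⟨_, hsub⟩ 0
  rw [map_zero, dist_zero_right, dist_zero_right] at this
  refine this.trans_eq ?_
  change _ * ‖f (x - p x)‖ = _
  rw [map_sub, hfp, sub_zero]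

/-- An operator that is bounded below off its kernel has closed range. -/
theorem isClosed_range_of_norm_sub_le [CompleteSpace W] {f : W →L[ℂ] E} {p : W →L[ℂ] W}
    (hfp : ∀ x, f (p x) = 0) (hid : ∀ x, f x = 0 → p x = x) {C : ℝ}
    (hC : ∀ x, ‖x - p x‖ ≤ C * ‖f x‖) : IsClosed (Set.range f) := by
  have : CompleteSpace p.ker := p.isClosed_ker.completeSpace_coe
  rw [← range_comp_subtypeL_ker hfp hid]
  refine isClosed_range_of_norm_le _ (C := C) fun x => ?_
  have h := hC x
  rw [show p (x : W) = 0 from x.2, sub_zero] at h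
  exact h

/-- An operator that is bounded below modulo a finite-rank operator has closed range. -/
theorem isClosed_range_of_norm_le_add_finiteRank [CompleteSpace W] {G : Type*}
    [NormedAddCommGroup G] [NormedSpace ℂ G] {f : W →L[ℂ] E} {g : W →L[ℂ] G} {C : ℝ}
    (h : ∀ x, ‖x‖ ≤ C * ‖f x‖ + ‖g x‖) [FiniteDimensional ℂ g.range] :
    IsClosed (Set.range f) := by
  have : CompleteSpace g.ker := g.isClosed_ker.completeSpace_coe
  have hcl : IsClosed (Set.range (f ∘L g.ker.subtypeL)) := by
    refine isClosed_range_of_norm_le _ (C := C) fun x => ?_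
    have hx := h x
    rw [show g (x : W) = 0 from x.2, norm_zero, add_zero] at hx
    exact hx
  -- On ker g, of finite codimension, f is bounded below; a finite-dimensional complement cannot
  -- spoil closedness of the image.
  have : g.ker.CoFG := Submodule.range_fg_iff_ker_cofg.1 (Module.Finite.iff_fg.1 ‹_›)
  have hmap : (g.ker.map f.toLinearMap : Set E) = Set.range (f ∘L g.ker.subtypeL) := by
    ext y
    simp
  exact LinearMap.isClosed_range_of_isClosed_map_of_finiteDimensional_quotient
    (f := f.toLinearMap) (s := g.ker) (hmap ▸ hcl)

end ContinuousLinearMap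

end BoundedBelow

/-! ### Hilbert modules over a general C⋆-algebra. -/

section GeneralModule

variable {A E : Type*} [NonUnitalCStarAlgebra A] [PartialOrder A]
  [NormedAddCommGroup E] [NormedSpace ℂ E] [SMul A E] [CStarModule A E]

namespace CStarModule

variable (A) in
theorem ext_inner_right {x y : E} (h : ∀ z : E, inner A z x = inner A z y) : x = y :=
  AdjointableOp.inner_ext (A := A) fun z => by
    rw [← star_inner z x, ← star_inner z y, h]

/-- The action is a bare `SMul`; its module laws are recovered by testing against inner products. -/
theorem mul_smul_apply (a b : A) (x : E) : (a * b) • x = a • b • x :=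
  ext_inner_right A fun z => by simp [mul_assoc]

theorem complex_smul_smul (c : ℂ) (a : A) (x : E) : (c • a) • x = c • a • x :=
  ext_inner_right A fun z => by simp [smul_mul_assoc]

theorem zero_smul_apply (x : E) : (0 : A) • x = 0 :=
  ext_inner_right A fun z => by simp

theorem sum_smul_apply {ι : Type*} (s : Finset ι) (a : ι → A) (x : E) :
    (∑ i ∈ s, a i) • x = ∑ i ∈ s, a i • x :=
  ext_inner_right A fun z => by simp [Finset.sum_mul]

theorem norm_smul_le_norm (a : A) (x : E) : ‖a • x‖ ≤ ‖a‖ * ‖x‖ := by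
  refine le_of_sq_le_sq ?_ (by positivity)
  rw [norm_sq_eq A, inner_op_smul_left, inner_op_smul_right, mul_pow, norm_sq_eq A (x := x)]
  calc ‖a * inner A x x * star a‖ ≤ ‖a‖ * ‖inner A x x‖ * ‖star a‖ :=
        (norm_mul_le _ _).trans (by gcongr; exact norm_mul_le _ _)
    _ = ‖a‖ ^ 2 * ‖inner A x x‖ := by rw [norm_star]; ring

variable (E) in
/-- The action of an algebra element as a bounded linear operator. -/
noncomputable def smulCLM (a : A) : E →L[ℂ] E :=
  LinearMap.mkContinuous
    { toFun := fun x => a • x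
      map_add' := fun x y => ext_inner_right A fun z => by simp [mul_add]
      map_smul' := fun c x => ext_inner_right A fun z => by simp [mul_smul_comm] }
    ‖a‖ (norm_smul_le_norm a)

@[simp]
theorem smulCLM_apply (a : A) (x : E) : smulCLM E a x = a • x := rfl

end CStarModule

open CStarModule

namespace AdjointableOp

theorem map_smul_algebra (T : AdjointableOp A E) (a : A) (x : E) : T (a • x) = a • T x :=
  inner_ext (A := A) fun z => by simp [T.inner_adjoint]

theorem smul_mem_ker (T : AdjointableOp A E) (a : A) (x : E)
    (hx : x ∈ LinearMap.ker T.toLinearMap) : a • x ∈ LinearMap.ker T.toLinearMap := by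
  have hx' : T x = 0 := hx
  change T (a • x) = 0
  rw [T.map_smul_algebra, hx']
  exact (smulCLM E a).map_zero

theorem inner_adjoint_left (T : AdjointableOp A E) (x y : E) :
    inner A (T.adjoint x) y = inner A x (T y) := by
  rw [← star_inner, ← T.inner_adjoint, star_inner]

@[simp]
theorem theta_apply (x y z : E) : theta (A := A) x y z = inner A x z • y := rfl

variable [StarOrderedRing A] [CompleteSpace E]

@[simp]
theorem toCLM_apply (T : AdjointableOp A E) (x : E) : T.toCLM x = T x := rfl

/-- `Θ_{x,y}` as a bounded linear function of `y`. -/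
noncomputable def thetaL (x : E) : E →L[ℂ] E →L[ℂ] E :=
  LinearMap.mkContinuous
    { toFun := fun y => (theta (A := A) x y).toCLM
      map_add' := fun y z => by
        ext w
        exact (smulCLM E (inner A x w)).map_add y z
      map_smul' := fun c y => by
        ext w
        exact (smulCLM E (inner A x w)).map_smul c y } ‖x‖ fun y =>
    ContinuousLinearMap.opNorm_le_bound _ (by positivity) fun z =>
      (norm_smul_le_norm _ _).trans <| by
        have := norm_inner_le (A := A) E (x := x) (y := z)
        calc ‖inner A x z‖ * ‖y‖ ≤ (‖x‖ * ‖z‖) * ‖y‖ := by gcongr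
          _ = ‖x‖ * ‖y‖ * ‖z‖ := by ring

end AdjointableOp

variable [StarOrderedRing A]

open AdjointableOp

/-- Cauchy–Schwarz applied to ‖G y‖² = ‖⟨F (G y), y⟩‖. This makes taking adjoints compatible with
norm limits. -/
theorem norm_le_of_inner_eq {F G : E →L[ℂ] E}
    (h : ∀ x y : E, inner A (F x) y = inner A x (G y)) : ‖G‖ ≤ ‖F‖ := by
  refine ContinuousLinearMap.opNorm_le_bound _ (norm_nonneg _) fun y => ?_
  rcases eq_or_ne (G y) 0 with h0 | h0
  · rw [h0, norm_zero]; positivity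
  · refine le_of_mul_le_mul_right ?_ (norm_pos_iff.2 h0)
    calc ‖G y‖ * ‖G y‖ = ‖inner A (F (G y)) y‖ := by rw [h, ← norm_sq_eq A, sq]
      _ ≤ ‖F (G y)‖ * ‖y‖ := norm_inner_le E
      _ ≤ ‖F‖ * ‖G y‖ * ‖y‖ := by gcongr; exact F.le_opNorm _
      _ = ‖F‖ * ‖y‖ * ‖G y‖ := by ring

variable [CompleteSpace E]

theorem theta_mem_moduleCompacts (x y : E) :
    (theta (A := A) x y).toCLM ∈ moduleCompacts A E :=
  Submodule.le_topologicalClosure _ (Submodule.subset_span ⟨(x, y), rfl⟩)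

theorem isClosed_moduleCompacts : IsClosed (moduleCompacts A E : Set (E →L[ℂ] E)) :=
  Submodule.isClosed_topologicalClosure _

/-- `K(E)` is the smallest closed subspace containing all `Θ_{x,y}`. -/
theorem moduleCompacts_le {V : Submodule ℂ (E →L[ℂ] E)} (hV : IsClosed (V : Set (E →L[ℂ] E)))
    (h : ∀ x y : E, (theta (A := A) x y).toCLM ∈ V) : moduleCompacts A E ≤ V := by
  refine Submodule.topologicalClosure_minimal _ (Submodule.span_le.2 ?_) hV
  rintro _ ⟨p, rfl⟩
  exact h p.1 p.2

/-- The adjoint of Θ_{x,y} is Θ_{y,x}, so the span is stable under adjoints, and the norm estimate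
extends this to the closure. -/
theorem adjoint_mem_moduleCompacts {k k' : E →L[ℂ] E}
    (h : ∀ x y : E, inner A (k x) y = inner A x (k' y)) (hk : k ∈ moduleCompacts A E) :
    k' ∈ moduleCompacts A E := by
  have key : ∀ F ∈ Submodule.span ℂ
      (Set.range fun p : E × E => (theta (A := A) p.1 p.2).toCLM),
      ∃ G ∈ moduleCompacts A E, ∀ x y : E, inner A (F x) y = inner A x (G y) := by
    intro F hF
    induction hF using Submodule.span_induction with
    | mem F hF =>
      obtain ⟨p, rfl⟩ := hF
      exact ⟨_, theta_mem_moduleCompacts p.2 p.1, fun x y => by simp⟩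
    | zero => exact ⟨0, zero_mem _, fun x y => by simp⟩
    | add F₁ F₂ _ _ h₁ h₂ =>
      obtain ⟨G₁, hG₁, h₁⟩ := h₁
      obtain ⟨G₂, hG₂, h₂⟩ := h₂
      exact ⟨G₁ + G₂, add_mem hG₁ hG₂, fun x y => by simp [h₁, h₂]⟩
    | smul c F _ h =>
      obtain ⟨G, hG, h⟩ := h
      exact ⟨star c • G, Submodule.smul_mem _ _ hG, fun x y => by simp [h]⟩
  refine isClosed_moduleCompacts.closure_subset (Metric.mem_closure_iff.2 fun ε hε => ?_)
  obtain ⟨F, hF, hkF⟩ := Metric.mem_closure_iff.1 hk ε hε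
  obtain ⟨G, hG, hFG⟩ := key F hF
  refine ⟨G, hG, lt_of_le_of_lt ?_ hkF⟩
  rw [dist_eq_norm, dist_eq_norm]
  exact norm_le_of_inner_eq (A := A) fun x y => by simp [h, hFG]

/-- A finite orthonormal basis of a submodule gives an orthogonal projection in `K(E)`. -/
theorem exists_projection_of_finite_basis {X : Submodule ℂ E}
    (hXA : ∀ (a : A), ∀ x ∈ X, a • x ∈ X) (hd : orthonormalDim A X < ⊤) :
    ∃ P : AdjointableOp A E, (∀ x y, inner A (P x) y = inner A x (P y)) ∧ (∀ x, P x ∈ X) ∧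
      (∀ x ∈ X, P x = x) ∧ P.toCLM ∈ moduleCompacts A E := by
  simp only [orthonormalDim, iInf_lt_iff] at hd
  obtain ⟨S, ⟨hSX, ⟨hmin, horth⟩, hdense⟩, hfin⟩ := hd
  have hfin' : S.Finite := Set.encard_lt_top_iff.1 hfin
  have hsymm : ∀ x y, inner A (∑ s ∈ hfin'.toFinset, inner A s x • s) y =
      inner A x (∑ s ∈ hfin'.toFinset, inner A s y • s) := fun x y => by simp
  let P : AdjointableOp A E := ⟨fun x => ∑ s ∈ hfin'.toFinset, inner A s x • s, _, hsymm⟩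
  have hP : ∀ x, P x = ∑ s ∈ hfin'.toFinset, inner A s x • s := fun _ => rfl
  -- With p = ⟨s, s⟩ a projection, the inner square of p • s - s is p - p - p + p = 0.
  have hself : ∀ s ∈ S, inner A s s • s = s := fun s hs => by
    have hp := (hmin s hs).1
    rw [← sub_eq_zero, ← CStarModule.inner_self (A := A)]
    simp [hp.isIdempotentElem.eq]
  have hPS : ∀ s ∈ S, P s = s := fun s hs => by
    rw [hP, Finset.sum_eq_single s]
    · exact hself s hs
    · intro t ht hts
      rw [horth (hfin'.mem_toFinset.1 ht) hs hts, zero_smul_apply]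
    · exact fun h => absurd (hfin'.mem_toFinset.2 hs) h
  refine ⟨P, hsymm, fun x => ?_, fun x hx => ?_, ?_⟩
  · exact Submodule.sum_mem _ fun s hs => hXA _ _ (hSX (hfin'.mem_toFinset.1 hs))
  · have hle : generatedSubmodule A S ≤ LinearMap.eqLocus P.toCLM.toLinearMap LinearMap.id := by
      refine Submodule.span_le.2 ?_
      rintro y (hy | ⟨a, s, hs, rfl⟩)
      · exact hPS y hy
      · exact (P.map_smul_algebra a s).trans (by rw [hPS s hs]; rfl)
    have hcl : IsClosed {x | P.toCLM x = x} := isClosed_eq P.toCLM.continuous continuous_id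
    exact closure_minimal (fun y hy => hle hy) hcl (hdense hx)
  · have : P.toCLM = ∑ s ∈ hfin'.toFinset, (theta (A := A) s s).toCLM := by
      ext x
      simp [hP]
    rw [this]
    exact Submodule.sum_mem _ fun s _ => theta_mem_moduleCompacts s s

/-- The adjoint of a right parametrix of `T` is a left parametrix of the adjoint of `T`. -/
theorem adjoint_comp_adjoint_sub_id_mem {T S : AdjointableOp A E}
    (h : T.toCLM ∘L S.toCLM - ContinuousLinearMap.id ℂ E ∈ moduleCompacts A E) :
    S.adjoint.toCLM ∘L T.adjoint.toCLM - ContinuousLinearMap.id ℂ E ∈ moduleCompacts A E :=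
  adjoint_mem_moduleCompacts (fun x y => by simp [inner_adjoint]) h

/-- If `P`, `Q` are projections in `K(E)` onto the kernels of `T` and its adjoint, and `T⋆T + P` is
bijective, then `T` is Fredholm. -/
theorem AdjointableOp.isFredholm_of_bijective {T P Q : AdjointableOp A E}
    (hPsymm : ∀ x y, inner A (P x) y = inner A x (P y)) (hTP : ∀ x, T (P x) = 0)
    (hPid : ∀ x, T x = 0 → P x = x) (hPK : P.toCLM ∈ moduleCompacts A E)
    (hQsymm : ∀ x y, inner A (Q x) y = inner A x (Q y)) (hTQ : ∀ x, T.adjoint (Q x) = 0)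
    (hQid : ∀ x, T.adjoint x = 0 → Q x = x) (hQK : Q.toCLM ∈ moduleCompacts A E)
    (hbij : Function.Bijective fun x => T.adjoint (T x) + P x) : T.IsFredholm := by
  obtain ⟨s, hsl, hsr⟩ := Function.bijective_iff_has_inverse.1 hbij
  have hsl' : ∀ x, s (T.adjoint (T x) + P x) = x := hsl
  have hsr' : ∀ x, T.adjoint (T (s x)) + P (s x) = x := hsr
  have hBsymm : ∀ x y, inner A (T.adjoint (T x) + P x) y = inner A x (T.adjoint (T y) + P y) :=
    fun x y => by
      rw [CStarModule.inner_add_left, CStarModule.inner_add_right, inner_adjoint_left,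
        inner_adjoint, hPsymm]
  have hssymm : ∀ x y, inner A (s x) y = inner A x (s y) := fun x y => by
    conv_lhs => rw [← hsr' y]
    rw [← hBsymm, hsr']
  let S : AdjointableOp A E := ⟨s, s, hssymm⟩
  have hadj0 : T.adjoint 0 = 0 := T.adjoint.toCLM.map_zero
  have hsP : ∀ x, s (P x) = P x := fun x => by
    have := hsl' (P x)
    rwa [hTP, hadj0, zero_add, hPid _ (hTP x)] at this
  have hPT : ∀ y, P (T.adjoint y) = 0 := fun y => inner_ext (A := A) fun z => by
    rw [hPsymm, inner_adjoint_left, hTP]; simp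
  have hQT : ∀ y, Q (T y) = 0 := fun y => inner_ext (A := A) fun z => by
    rw [hQsymm, inner_adjoint, hTQ]; simp
  have hPs : ∀ x, P (s x) = P x := fun x => inner_ext (A := A) fun z => by
    rw [hPsymm, hssymm, hsP, hPsymm]
  let R : AdjointableOp A E := ⟨fun x => s (T.adjoint x), fun x => T (s x), fun x y => by
    rw [hssymm, inner_adjoint_left]⟩
  have hR : ∀ x, R x = s (T.adjoint x) := fun _ => rfl
  refine ⟨⟨R, ?_⟩, ⟨R, ?_⟩⟩
  · have : R.toCLM ∘L T.toCLM - ContinuousLinearMap.id ℂ E = -P.toCLM := by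
      ext x
      have h := S.toCLM.map_add (T.adjoint (T x)) (P x)
      change s _ = s _ + s _ at h
      rw [hsl', hsP] at h
      change s (T.adjoint (T x)) - x = -P x
      nth_rewrite 2 [h]
      abel
    rw [this]
    exact neg_mem hPK
  · have : T.toCLM ∘L R.toCLM - ContinuousLinearMap.id ℂ E = -Q.toCLM := by
      ext y
      -- The defect y - T R y lies in Ker T⋆, so Q fixes it; since Q T = 0, it equals Q y.
      have hw : T.adjoint.toCLM (y - T (R y)) = 0 := by
        rw [map_sub, toCLM_apply, toCLM_apply, hR, sub_eq_zero]
        have h := hsr' (T.adjoint y)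
        rw [hPs, hPT, add_zero] at h
        exact h.symm
      have hQw : Q.toCLM (y - T (R y)) = y - T (R y) := hQid _ hw
      rw [map_sub, toCLM_apply, toCLM_apply, hQT, sub_zero] at hQw
      change T (R y) - y = -Q y
      rw [hQw]
      abel
    rw [this]
    exact neg_mem hQK

end GeneralModule

/-! ### Rank-one operators in 𝒦(H). -/

section RankOne

variable {H : Type*} [NormedAddCommGroup H] [InnerProductSpace ℂ H] [CompleteSpace H]

namespace compactAlgebra

/-- The rank-one operator `ζ ↦ ⟪η, ζ⟫ ξ` as an element of `𝒦(H)`. -/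
noncomputable def rk (ξ η : H) : compactAlgebra H :=
  ⟨InnerProductSpace.rankOne ℂ ξ η, by
    have h : IsCompactOperator (InnerProductSpace.rankOne ℂ ξ η) := by
      rw [InnerProductSpace.rankOne_def']
      exact (isCompactOperator_of_locallyCompactSpace_rng
        (ContinuousLinearMap.toSpanSingleton ℂ ξ)).comp_clm (innerSL ℂ η)
    exact h⟩

@[simp]
theorem coe_rk (ξ η : H) : (rk ξ η : H →L[ℂ] H) = InnerProductSpace.rankOne ℂ ξ η := rfl

theorem rk_mul_mul_rk (ξ η ζ θ : H) (a : compactAlgebra H) :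
    rk ξ η * a * rk ζ θ = ⟪η, (a : H →L[ℂ] H) ζ⟫_ℂ • rk ξ θ := by
  refine Subtype.ext (ContinuousLinearMap.ext fun z => ?_)
  simp [smul_smul, mul_comm]

theorem rk_mul_rk (ξ η ζ θ : H) : rk ξ η * rk ζ θ = ⟪η, ζ⟫_ℂ • rk ξ θ := by
  refine Subtype.ext (ContinuousLinearMap.ext fun z => ?_)
  simp [smul_smul, mul_comm]

theorem star_rk (ξ η : H) : star (rk ξ η) = rk η ξ :=
  Subtype.ext (InnerProductSpace.adjoint_rankOne ξ η)

theorem norm_rk (ξ η : H) : ‖rk ξ η‖ = ‖ξ‖ * ‖η‖ :=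
  InnerProductSpace.norm_rankOne ξ η

/-- Compact operators are approximated by their compressions to finite-dimensional subspaces. -/
theorem exists_norm_sub_sum_rk_mul_le (a : compactAlgebra H) {ε : ℝ} (hε : 0 < ε) :
    ∃ (n : ℕ) (b : Fin n → H), ‖∑ i, rk (b i) (b i)‖ ≤ 1 ∧
      ‖a - (∑ i, rk (b i) (b i)) * a‖ ≤ ε := by
  have ha : IsCompactOperator (a : H →L[ℂ] H) := a.2
  have htb : TotallyBounded ((a : H →L[ℂ] H) '' Metric.closedBall 0 1) :=
    (ha.isCompact_closure_image_closedBall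
      (f := ((a : H →L[ℂ] H) : H →ₗ[ℂ] H)) 1).totallyBounded.subset subset_closure
  obtain ⟨t, htf, htc⟩ := Metric.totallyBounded_iff.1 htb ε hε
  -- V is spanned by a finite ε-net of the image of the unit ball, so projecting onto V moves each
  -- image point by at most ε.
  let V : Submodule ℂ H := Submodule.span ℂ t
  have : FiniteDimensional ℂ V := FiniteDimensional.span_of_finite ℂ htf
  let b := stdOrthonormalBasis ℂ V
  have hsum : ((∑ i, rk (b i : H) (b i : H) : compactAlgebra H) : H →L[ℂ] H) =
      V.starProjection := by
    rw [b.starProjection_eq_sum_rankOne]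
    simp
  refine ⟨_, fun i => b i, ?_, ?_⟩
  · change ‖((∑ i, rk (b i : H) (b i : H) : compactAlgebra H) : H →L[ℂ] H)‖ ≤ 1
    rw [hsum]
    exact V.starProjection_norm_le
  · change ‖(a : H →L[ℂ] H) - ((∑ i, rk (b i : H) (b i : H) : compactAlgebra H) : H →L[ℂ] H)
      * (a : H →L[ℂ] H)‖ ≤ ε
    rw [hsum]
    refine ContinuousLinearMap.opNorm_le_of_unit_norm hε.le fun x hx => ?_
    have hx' := htc ⟨x, by simp [hx], rfl⟩
    simp only [Set.mem_iUnion, Metric.mem_ball, exists_prop] at hx'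
    obtain ⟨y, hy, hxy⟩ := hx'
    have hmin := V.starProjection_minimal ((a : H →L[ℂ] H) x)
    change ‖(a : H →L[ℂ] H) x - V.starProjection ((a : H →L[ℂ] H) x)‖ ≤ ε
    rw [hmin]
    refine (ciInf_le ⟨0, ?_⟩ (⟨y, Submodule.subset_span hy⟩ : V)).trans ?_
    · rintro _ ⟨w, rfl⟩; exact norm_nonneg _
    · rw [← dist_eq_norm]; exact hxy.le

end compactAlgebra

end RankOne

open compactAlgebra CStarModule AdjointableOp

/-! ### The Hilbert space corner eE and how it controls E. -/

section CompactModule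

variable {H : Type*} [NormedAddCommGroup H] [InnerProductSpace ℂ H] [CompleteSpace H]
  {E : Type*} [NormedAddCommGroup E] [NormedSpace ℂ E]
  [SMul (compactAlgebra H) E] [CStarModule (compactAlgebra H) E]

variable (H) in
/-- Every vector is a limit of combinations of its cut-downs by rank-one positive operators. -/
theorem mem_closure_span_rk_smul (x : E) :
    x ∈ closure (Submodule.span ℂ (Set.range fun η : H => rk η η • x) : Set E) := by
  refine Metric.mem_closure_iff.2 fun ε hε => ?_
  -- The inner square of x - f • x is (a - f a)(1 - f) with ‖f‖ ≤ 1, so its norm is at most 2 · ε²/4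
  -- < ε².
  obtain ⟨n, b, hb, hab⟩ :=
    exists_norm_sub_sum_rk_mul_le (inner (compactAlgebra H) x x) (ε := ε ^ 2 / 4) (by positivity)
  set f : compactAlgebra H := ∑ i, rk (b i) (b i) with hf
  have hfs : star f = f := by simp [hf, star_rk]
  refine ⟨f • x, ?_, ?_⟩
  · rw [hf, sum_smul_apply]
    exact Submodule.sum_mem _ fun i _ => Submodule.subset_span ⟨b i, rfl⟩
  · rw [dist_eq_norm]
    refine lt_of_pow_lt_pow_left₀ 2 hε.le ?_
    rw [norm_sq_eq (compactAlgebra H)]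
    set a := inner (compactAlgebra H) x x with ha
    have h : inner (compactAlgebra H) (x - f • x) (x - f • x) =
        (a - f * a) - (a - f * a) * f := by
      simp only [CStarModule.inner_sub_left, CStarModule.inner_sub_right,
        inner_op_smul_left, inner_op_smul_right, hfs,
        ← ha, sub_mul, mul_sub, mul_assoc]
      abel
    rw [h]
    calc _ ≤ ‖a - f * a‖ + ‖(a - f * a) * f‖ := norm_sub_le _ _
      _ ≤ ‖a - f * a‖ + ‖a - f * a‖ * 1 := by
        gcongr
        exact (norm_mul_le _ _).trans (by gcongr)
      _ ≤ ε ^ 2 / 4 + ε ^ 2 / 4 * 1 := by gcongr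
      _ < ε ^ 2 := by nlinarith [pow_pos hε 2]

variable (E) in
/-- The corner `e E` cut out by the rank-one operator `e = ξ ⊗ ξ`. -/
noncomputable def corner (ξ : H) : Submodule ℂ E :=
  LinearMap.ker (smulCLM E (rk ξ ξ) - ContinuousLinearMap.id ℂ E).toLinearMap

theorem mem_corner {ξ : H} {x : E} : x ∈ corner E ξ ↔ rk ξ ξ • x = x := by
  change rk ξ ξ • x - x = 0 ↔ _
  exact sub_eq_zero

variable (E) in
theorem isClosed_corner (ξ : H) : IsClosed (corner E ξ : Set E) :=
  (smulCLM E (rk ξ ξ) - ContinuousLinearMap.id ℂ E).isClosed_ker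

theorem rk_smul_mem_corner {ξ : H} (hξ : ‖ξ‖ = 1) (η : H) (x : E) :
    rk ξ η • x ∈ corner E ξ := by
  rw [mem_corner, ← mul_smul_apply, rk_mul_rk, inner_self_eq_norm_sq_to_K, hξ]
  simp

/-- This factors each cut-down of x through the corner, so that the corner generates a dense
submodule. -/
theorem rk_smul_rk_smul {ξ : H} (hξ : ‖ξ‖ = 1) (η : H) (x : E) :
    rk η ξ • rk ξ η • x = rk η η • x := by
  rw [← mul_smul_apply, rk_mul_rk, inner_self_eq_norm_sq_to_K, hξ]
  simp

theorem AdjointableOp.map_mem_corner (T : AdjointableOp (compactAlgebra H) E) {ξ : H} {x : E}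
    (hx : x ∈ corner E ξ) : T x ∈ corner E ξ := by
  rw [mem_corner] at hx ⊢
  rw [← T.map_smul_algebra, hx]

/-- Both vectors absorb e, and e a e is a multiple of e; the coefficient serves as the scalar inner
product of the corner. -/
theorem inner_eq_smul_rk_of_mem_corner {ξ : H} {x y : E} (hx : x ∈ corner E ξ)
    (hy : y ∈ corner E ξ) : inner (compactAlgebra H) x y =
      ⟪ξ, (inner (compactAlgebra H) x y : H →L[ℂ] H) ξ⟫_ℂ • rk ξ ξ := by
  rw [← rk_mul_mul_rk]
  conv_lhs => rw [← mem_corner.1 hx, ← mem_corner.1 hy]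
  rw [inner_op_smul_left, inner_op_smul_right, star_rk]

theorem isPositive_inner_self (x : E) :
    (inner (compactAlgebra H) x x : H →L[ℂ] H).IsPositive := by
  have h : 0 ≤ inner (compactAlgebra H) x x := CStarModule.inner_self_nonneg
  exact (ContinuousLinearMap.nonneg_iff_isPositive _).1 h

/-- The norm of a rank-one cut-down is a diagonal coefficient of the operator-valued norm. -/
theorem norm_rk_smul_sq {ξ : H} (hξ : ‖ξ‖ = 1) (η : H) (x : E) :
    ‖rk ξ η • x‖ ^ 2 = (⟪η, (inner (compactAlgebra H) x x : H →L[ℂ] H) η⟫_ℂ).re := by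
  rw [norm_sq_eq (compactAlgebra H), inner_op_smul_left, inner_op_smul_right, star_rk,
    rk_mul_mul_rk, norm_smul, norm_rk, hξ]
  have h := (isPositive_inner_self (H := H) x).inner_nonneg_right η
  have h' := congrArg Complex.re (Complex.eq_coe_norm_of_nonneg h)
  rw [Complex.ofReal_re] at h'
  rw [h', mul_one, mul_one]

/-- The corner is a Hilbert space. -/
noncomputable abbrev cornerInnerProductSpace {ξ : H} (hξ : ‖ξ‖ = 1) :
    InnerProductSpace ℂ (corner E ξ) where
  inner x y := ⟪ξ, (inner (compactAlgebra H) (x : E) (y : E) : H →L[ℂ] H) ξ⟫_ℂ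
  norm_sq_eq_re_inner x := by
    have h := norm_rk_smul_sq hξ ξ (x : E)
    rw [mem_corner.1 x.2] at h
    exact h
  conj_inner_symm x y := by
    rw [inner_conj_symm, ← star_inner (y : E) (x : E)]
    exact (ContinuousLinearMap.adjoint_inner_right
      (inner (compactAlgebra H) (y : E) (x : E) : H →L[ℂ] H) ξ ξ).symm
  add_left x y z := by simp
  smul_left x y c := by simp

theorem isMinimalProjection_rk {ξ : H} (hξ : ‖ξ‖ = 1) : IsMinimalProjection (rk ξ ξ) := by
  refine ⟨⟨?_, star_rk ξ ξ⟩, ?_, fun a => ⟨_, rk_mul_mul_rk ξ ξ ξ ξ a⟩⟩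
  · rw [IsIdempotentElem, rk_mul_rk, inner_self_eq_norm_sq_to_K, hξ]
    simp
  · rw [← norm_ne_zero_iff, norm_rk, hξ]
    simp

/-- A norm estimate between the rank-one cut-downs of two vectors passes to the vectors. -/
theorem norm_le_of_norm_rk_smul_le {ξ : H} (hξ : ‖ξ‖ = 1) {x y : E} {C : ℝ} (hC : 0 ≤ C)
    (h : ∀ η : H, ‖rk ξ η • x‖ ≤ C * ‖rk ξ η • y‖) : ‖x‖ ≤ C * ‖y‖ := by
  refine le_of_sq_le_sq ?_ (by positivity)
  rw [mul_pow, norm_sq_eq (compactAlgebra H), norm_sq_eq (compactAlgebra H) (x := y)]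
  change ‖(inner (compactAlgebra H) x x : H →L[ℂ] H)‖ ≤
    C ^ 2 * ‖(inner (compactAlgebra H) y y : H →L[ℂ] H)‖
  set a : H →L[ℂ] H := (inner (compactAlgebra H) x x : H →L[ℂ] H) with ha
  set b : H →L[ℂ] H := (inner (compactAlgebra H) y y : H →L[ℂ] H) with hb
  have hapos : a.IsPositive := isPositive_inner_self x
  have hbpos : b.IsPositive := isPositive_inner_self y
  have hbpos' : (((C ^ 2 : ℝ) : ℂ) • b).IsPositive :=
    hbpos.smul_of_nonneg (by exact_mod_cast sq_nonneg C)
  -- By `norm_rk_smul_sq`, the estimates over all η are together an inequality of quadratic forms;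
  -- the norm is monotone on positive operators.
  have hle : a ≤ ((C ^ 2 : ℝ) : ℂ) • b := by
    rw [ContinuousLinearMap.le_def, ContinuousLinearMap.isPositive_def']
    refine ⟨hbpos'.isSelfAdjoint.sub hapos.isSelfAdjoint, fun η => ?_⟩
    have h1 : ‖rk ξ η • x‖ ^ 2 ≤ C ^ 2 * ‖rk ξ η • y‖ ^ 2 := by
      rw [← mul_pow]
      exact pow_le_pow_left₀ (norm_nonneg _) (h η) 2
    rw [norm_rk_smul_sq hξ, norm_rk_smul_sq hξ, ← ha, ← hb] at h1
    rw [ContinuousLinearMap.reApplyInnerSelf_apply, ← inner_re_symm]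
    rw [sub_apply, smul_apply, _root_.inner_sub_right, _root_.inner_smul_right, map_sub]
    change 0 ≤ (((C ^ 2 : ℝ) : ℂ) * _).re - _
    rw [Complex.re_ofReal_mul]
    exact sub_nonneg.2 h1
  calc ‖a‖ ≤ ‖((C ^ 2 : ℝ) : ℂ) • b‖ := CStarAlgebra.norm_le_norm_of_nonneg_of_le
        ((ContinuousLinearMap.nonneg_iff_isPositive _).2 hapos) hle
    _ = C ^ 2 * ‖b‖ := by
        rw [norm_smul, Complex.norm_real, Real.norm_of_nonneg (sq_nonneg C)]

/-- A submodule whose corner is finite-dimensional has a finite orthonormal basis. -/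
theorem orthonormalDim_lt_top {ξ : H} (hξ : ‖ξ‖ = 1) {X : Submodule ℂ E}
    (hXA : ∀ (a : compactAlgebra H), ∀ x ∈ X, a • x ∈ X)
    [FiniteDimensional ℂ (X.comap (corner E ξ).subtype)] :
    orthonormalDim (compactAlgebra H) X < ⊤ := by
  let : InnerProductSpace ℂ (corner E ξ) := cornerInnerProductSpace hξ
  let b := stdOrthonormalBasis ℂ (X.comap (corner E ξ).subtype)
  let v : _ → E := fun i => ((b i : corner E ξ) : E)
  have hv : ∀ i j, inner (compactAlgebra H) (v i) (v j) = (if i = j then (1 : ℂ) else 0) • rk ξ ξ :=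
    fun i j => by
      rw [← orthonormal_iff_ite.1 b.orthonormal i j]
      exact inner_eq_smul_rk_of_mem_corner (b i : corner E ξ).2 (b j : corner E ξ).2
  have hbasis : IsOrthonormalBasisOf (compactAlgebra H) X (Set.range v) := by
    refine ⟨?_, ⟨?_, ?_⟩, fun x hx => ?_⟩
    · rintro _ ⟨i, rfl⟩
      exact (b i).2
    · rintro _ ⟨i, rfl⟩
      rw [hv, if_pos rfl, one_smul]
      exact isMinimalProjection_rk hξ
    · rintro _ ⟨i, rfl⟩ _ ⟨j, rfl⟩ hij
      rw [hv, if_neg fun h : i = j => hij (congrArg v h), zero_smul]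
    · refine closure_mono ?_ (mem_closure_span_rk_smul H x)
      refine Submodule.span_le.2 ?_
      rintro _ ⟨η, rfl⟩
      let w : X.comap (corner E ξ).subtype :=
        ⟨⟨rk ξ η • x, rk_smul_mem_corner hξ η x⟩, hXA _ _ hx⟩
      have hw : rk ξ η • x = ∑ i, b.repr w i • v i := by
        have := congrArg (fun u : X.comap (corner E ξ).subtype => ((u : corner E ξ) : E))
          (b.sum_repr w)
        simpa [v] using this.symm
      change rk η η • x ∈ generatedSubmodule (compactAlgebra H) (Set.range v)
      rw [← rk_smul_rk_smul hξ, hw, ← smulCLM_apply, map_sum]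
      refine Submodule.sum_mem _ fun i _ => ?_
      rw [map_smul]
      exact Submodule.smul_mem _ _ (Submodule.subset_span (Or.inr ⟨_, _, ⟨i, rfl⟩, rfl⟩))
  exact (iInf₂_le _ hbasis).trans_lt (Set.encard_lt_top_iff.2 (Set.finite_range v))

variable [CompleteSpace E]

/-- A closed submodule with trivial orthogonal complement is everything. -/
theorem eq_top_of_orthogonal_eq_zero {ξ : H} (hξ : ‖ξ‖ = 1) {X : Submodule ℂ E}
    (hX : IsClosed (X : Set E)) (hXA : ∀ (a : compactAlgebra H), ∀ x ∈ X, a • x ∈ X)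
    (horth : ∀ y : E, (∀ x ∈ X, inner (compactAlgebra H) x y = 0) → y = 0) : X = ⊤ := by
  let : InnerProductSpace ℂ (corner E ξ) := cornerInnerProductSpace hξ
  have : CompleteSpace (corner E ξ) := (isClosed_corner E ξ).completeSpace_coe
  let Y : Submodule ℂ (corner E ξ) := X.comap (corner E ξ).subtype
  have hY : IsClosed (Y : Set (corner E ξ)) := hX.preimage continuous_subtype_val
  have : CompleteSpace Y := hY.completeSpace_coe
  have hYtop : Y = ⊤ := by
    rw [← Submodule.orthogonal_eq_bot_iff, Submodule.eq_bot_iff]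
    refine fun y hy => Subtype.ext (horth y fun x hx => ?_)
    have hyc := mem_corner.1 y.2
    refine Subtype.ext (ContinuousLinearMap.ext fun η => ?_)
    -- Scalar orthogonality to every `rk ξ η • x` kills the ξ-coefficient of ⟨x, y⟩ η; as y = e y,
    -- that is all of ⟨x, y⟩ η.
    have h0 : ⟪ξ, (inner (compactAlgebra H) (rk ξ η • x) (y : E) : H →L[ℂ] H) ξ⟫_ℂ = 0 :=
      (Submodule.mem_orthogonal Y y).1 hy ⟨_, rk_smul_mem_corner hξ η x⟩ (hXA _ _ hx)
    rw [inner_op_smul_left, star_rk] at h0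
    rw [← hyc, inner_op_smul_right]
    have h1 : ⟪ξ, (inner (compactAlgebra H) x (y : E) : H →L[ℂ] H) η⟫_ℂ = 0 := by
      simpa [hξ] using h0
    simp [h1]
  refine (Submodule.eq_top_iff').2 fun x => ?_
  refine hX.closure_subset (closure_mono ?_ (mem_closure_span_rk_smul H x))
  refine Submodule.span_le.2 ?_
  rintro _ ⟨η, rfl⟩
  have hmem : (⟨_, rk_smul_mem_corner hξ η x⟩ : corner E ξ) ∈ Y := hYtop ▸ Submodule.mem_top
  change rk η η • x ∈ X
  rw [← rk_smul_rk_smul hξ]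
  exact hXA _ _ hmem

/-! ### K(E) on the corner, and consequences of having a parametrix. -/

variable (E) in
/-- The operators whose restriction to the corner has finite rank. -/
def finiteRankOnCorner (ξ : H) : Submodule ℂ (E →L[ℂ] E) where
  carrier := {F | ∃ V : Submodule ℂ E, FiniteDimensional ℂ V ∧ ∀ x ∈ corner E ξ, F x ∈ V}
  zero_mem' := ⟨⊥, inferInstance, fun _ _ => zero_mem _⟩
  add_mem' := by
    rintro F G ⟨V, _, hV⟩ ⟨W, _, hW⟩
    exact ⟨V ⊔ W, inferInstance, fun x hx => Submodule.add_mem_sup (hV x hx) (hW x hx)⟩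
  smul_mem' := by
    rintro c F ⟨V, hfd, hV⟩
    exact ⟨V, hfd, fun x hx => V.smul_mem c (hV x hx)⟩

-- Approximate y by combinations of `rk η η • y`. For z in the corner, ⟨x, z⟩ absorbs e on the left,
-- and e a `rk η η` is a multiple of `rk ξ η`, so each such Θ has rank at most one there.
variable (E) in
theorem moduleCompacts_le_closure_finiteRankOnCorner (ξ : H) :
    moduleCompacts (compactAlgebra H) E ≤ (finiteRankOnCorner E ξ).topologicalClosure := by
  refine moduleCompacts_le (Submodule.isClosed_topologicalClosure _) fun x y => ?_
  have h := image_closure_subset_closure_image (thetaL (A := compactAlgebra H) x).continuous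
    ⟨y, mem_closure_span_rk_smul H y, rfl⟩
  refine closure_mono ?_ h
  rintro _ ⟨w, hw, rfl⟩
  refine (Submodule.span_le (p := (finiteRankOnCorner E ξ).comap
    (thetaL (A := compactAlgebra H) x).toLinearMap)).2 ?_ hw
  rintro _ ⟨η, rfl⟩
  refine ⟨Submodule.span ℂ {rk ξ η • y}, inferInstance, fun z hz => ?_⟩
  change inner (compactAlgebra H) x z • rk η η • y ∈ _
  rw [← mem_corner.1 hz]
  rw [inner_op_smul_right, ← mul_smul_apply, rk_mul_mul_rk, complex_smul_smul]
  exact Submodule.smul_mem _ _ (Submodule.mem_span_singleton_self _)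

/-- A left parametrix modulo `K(E)` can be improved to one modulo operators of finite rank on the
corner. -/
theorem exists_leftInverse_add_finiteRankOnCorner (ξ : H)
    {T S : AdjointableOp (compactAlgebra H) E}
    (h : S.toCLM ∘L T.toCLM - ContinuousLinearMap.id ℂ E ∈ moduleCompacts (compactAlgebra H) E) :
    ∃ R : E →L[ℂ] E, ∃ F ∈ finiteRankOnCorner E ξ, ∀ x, R (T x) = x + F x := by
  set k := S.toCLM ∘L T.toCLM - ContinuousLinearMap.id ℂ E with hk
  obtain ⟨F, ⟨V, hVfd, hV⟩, hF⟩ := Metric.mem_closure_iff.1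
    (moduleCompacts_le_closure_finiteRankOnCorner E ξ h) 1 one_pos
  rw [dist_comm, dist_eq_norm] at hF
  -- S T = (1 + k - F) + F with ‖F - k‖ < 1; the first summand is inverted by a Neumann series.
  let u := Units.oneSub (F - k) hF
  let U : E →L[ℂ] E := ↑u⁻¹
  have hU : ∀ x, U (x + k x - F x) = x := fun x => by
    have h1 : U * (u : E →L[ℂ] E) = 1 := u.inv_mul
    have h2 := congrArg (fun G : E →L[ℂ] E => G x) h1
    have h3 : (u : E →L[ℂ] E) x = x + k x - F x := by
      change x - (F x - k x) = _
      abel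
    rw [← h3]
    exact h2
  refine ⟨U ∘L S.toCLM, U ∘L F, ⟨V.map U.toLinearMap, inferInstance, fun x hx => ⟨_, hV x hx, rfl⟩⟩,
    fun x => ?_⟩
  have h4 : S (T x) = (x + k x - F x) + F x := by
    rw [hk]
    change S (T x) = x + (S (T x) - x) - F x + F x
    abel
  change U (S (T x)) = x + U (F x)
  rw [h4, map_add, hU]

/-- On Ker T the identity R T = 1 + F reads x = -F x, which confines the kernel inside the corner to
a finite-dimensional space. -/
theorem orthonormalDim_ker_lt_top {ξ : H} (hξ : ‖ξ‖ = 1) {T S : AdjointableOp (compactAlgebra H) E}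
    (h : S.toCLM ∘L T.toCLM - ContinuousLinearMap.id ℂ E ∈ moduleCompacts (compactAlgebra H) E) :
    orthonormalDim (compactAlgebra H) (LinearMap.ker T.toLinearMap) < ⊤ := by
  obtain ⟨R, F, ⟨V, hVfd, hV⟩, hR⟩ := exists_leftInverse_add_finiteRankOnCorner ξ h
  let Y := (LinearMap.ker T.toLinearMap).comap (corner E ξ).subtype
  have hmem : ∀ y : Y, ((corner E ξ).subtype ∘ₗ Y.subtype) y ∈ V := fun y => by
    have h1 := hR ((y : corner E ξ) : E)
    rw [show T ((y : corner E ξ) : E) = 0 from y.2, map_zero] at h1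
    have h2 : ((y : corner E ξ) : E) = -F ((y : corner E ξ) : E) :=
      eq_neg_of_add_eq_zero_left h1.symm
    change ((y : corner E ξ) : E) ∈ V
    rw [h2]
    exact neg_mem (hV _ (y : corner E ξ).2)
  have : FiniteDimensional ℂ Y := Module.Finite.of_injective
    (((corner E ξ).subtype ∘ₗ Y.subtype).codRestrict V hmem) fun y z hyz => by
      have := congrArg Subtype.val hyz
      exact Subtype.ext (Subtype.ext this)
  exact orthonormalDim_lt_top hξ (smul_mem_ker T)

/-- On the corner, x = R T x - F x bounds T below modulo finite rank, so T has closed range there.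
The resulting estimate for x - P x passes to E because T and P commute with the algebra action. -/
theorem isClosed_range_of_parametrix {ξ : H} (hξ : ‖ξ‖ = 1)
    {T S : AdjointableOp (compactAlgebra H) E}
    (h : S.toCLM ∘L T.toCLM - ContinuousLinearMap.id ℂ E ∈ moduleCompacts (compactAlgebra H) E) :
    IsClosed (Set.range T) := by
  obtain ⟨P, -, hTP, hid, -⟩ :=
    exists_projection_of_finite_basis (smul_mem_ker T) (orthonormalDim_ker_lt_top hξ h)
  have hTP' : ∀ x, T (P x) = 0 := hTP
  have hid' : ∀ x, T x = 0 → P x = x := hid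
  obtain ⟨R, F, ⟨V, hVfd, hV⟩, hR⟩ := exists_leftInverse_add_finiteRankOnCorner ξ h
  have : CompleteSpace (corner E ξ) := (isClosed_corner E ξ).completeSpace_coe
  let ι : corner E ξ →L[ℂ] E := (corner E ξ).subtypeL
  let p : corner E ξ →L[ℂ] corner E ξ :=
    (P.toCLM ∘L ι).codRestrict (corner E ξ) fun x => P.map_mem_corner x.2
  have hfin : FiniteDimensional ℂ (F ∘L ι).range :=
    Submodule.finiteDimensional_of_le (S₂ := V) (by rintro _ ⟨x, rfl⟩; exact hV _ x.2)
  have hcl : IsClosed (Set.range (T.toCLM ∘L ι)) := by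
    refine ContinuousLinearMap.isClosed_range_of_norm_le_add_finiteRank (g := F ∘L ι) (C := ‖R‖)
      fun x => ?_
    have hx : (x : E) = R (T x) - F x := by rw [hR]; abel
    calc ‖x‖ = ‖(x : E)‖ := rfl
      _ = ‖R (T x) - F x‖ := congrArg _ hx
      _ ≤ ‖R (T x)‖ + ‖F x‖ := norm_sub_le _ _
      _ ≤ ‖R‖ * ‖T x‖ + ‖F x‖ := by gcongr; exact R.le_opNorm _
  obtain ⟨C, hC, hbd⟩ := ContinuousLinearMap.exists_norm_sub_le_of_isClosed_range (p := p)
    (fun x => hTP' x) (fun x hx => Subtype.ext (hid' x hx)) hcl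
  refine ContinuousLinearMap.isClosed_range_of_norm_sub_le (f := T.toCLM) (p := P.toCLM) hTP' hid'
    (C := C) fun x => norm_le_of_norm_rk_smul_le hξ hC fun η => ?_
  have h1 := hbd ⟨_, rk_smul_mem_corner hξ η x⟩
  rw [← smulCLM_apply (rk ξ η) (x - _), map_sub, smulCLM_apply, smulCLM_apply, toCLM_apply,
    toCLM_apply, ← P.map_smul_algebra, ← T.map_smul_algebra]
  exact h1

/-! ### Invertibility of T⋆T + P, and the theorem. -/

/-- If `T` has closed range and `P` is a projection onto its kernel, then `T⋆T + P` is bijective. -/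
theorem bijective_adjoint_mul_self_add {ξ : H} (hξ : ‖ξ‖ = 1)
    {T P : AdjointableOp (compactAlgebra H) E} (hT : IsClosed (Set.range T))
    (hPsymm : ∀ x y, inner (compactAlgebra H) (P x) y = inner (compactAlgebra H) x (P y))
    (hTP : ∀ x, T (P x) = 0) (hid : ∀ x, T x = 0 → P x = x) :
    Function.Bijective fun x => T.adjoint (T x) + P x := by
  obtain ⟨C, hC, hbd⟩ := ContinuousLinearMap.exists_norm_sub_le_of_isClosed_range (f := T.toCLM)
    (p := P.toCLM) hTP hid hT
  let B : E →L[ℂ] E := T.adjoint.toCLM ∘L T.toCLM + P.toCLM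
  have hB : ∀ x, B x = T.adjoint (T x) + P x := fun _ => rfl
  have hBsymm : ∀ x y, inner (compactAlgebra H) (B x) y = inner (compactAlgebra H) x (B y) :=
    fun x y => by
      rw [hB, hB, CStarModule.inner_add_left, CStarModule.inner_add_right, inner_adjoint_left,
        inner_adjoint, hPsymm]
  have hPP : ∀ x, P (P x) = P x := fun x => hid _ (hTP x)
  have hBx : ∀ x, inner (compactAlgebra H) x (B x) =
      inner (compactAlgebra H) (T x) (T x) + inner (compactAlgebra H) (P x) (P x) := fun x => by
    rw [hB, CStarModule.inner_add_right, ← inner_adjoint, hPsymm, hPP]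
  have hTle : ∀ x, ‖T x‖ ^ 2 ≤ ‖x‖ * ‖B x‖ := fun x => by
    refine le_trans ?_ (norm_inner_le (A := compactAlgebra H) E)
    rw [norm_sq_eq (compactAlgebra H), hBx]
    exact CStarAlgebra.norm_le_norm_of_nonneg_of_le CStarModule.inner_self_nonneg
      (le_add_of_nonneg_right CStarModule.inner_self_nonneg)
  have hPle : ∀ x, ‖P x‖ ^ 2 ≤ ‖x‖ * ‖B x‖ := fun x => by
    refine le_trans ?_ (norm_inner_le (A := compactAlgebra H) E)
    rw [norm_sq_eq (compactAlgebra H), hBx]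
    exact CStarAlgebra.norm_le_norm_of_nonneg_of_le CStarModule.inner_self_nonneg
      (le_add_of_nonneg_left CStarModule.inner_self_nonneg)
  -- Both ‖T x‖ and ‖P x‖ are at most m = √(‖x‖ ‖B x‖), so ‖x‖ ≤ (C + 1) m; square and cancel ‖x‖.
  have hlow : ∀ x, ‖x‖ ≤ (C + 1) ^ 2 * ‖B x‖ := fun x => by
    rcases eq_or_ne x 0 with rfl | hx
    · rw [norm_zero]; positivity
    refine le_of_mul_le_mul_left ?_ (norm_pos_iff.2 hx)
    have h1 : ‖x‖ ≤ C * ‖T x‖ + ‖P x‖ := by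
      calc ‖x‖ = ‖(x - P x) + P x‖ := by rw [sub_add_cancel]
        _ ≤ ‖x - P x‖ + ‖P x‖ := norm_add_le _ _
        _ ≤ _ := by gcongr; exact hbd x
    set m := √(‖x‖ * ‖B x‖) with hm
    have hTm : ‖T x‖ ≤ m := Real.le_sqrt_of_sq_le (hTle x)
    have hPm : ‖P x‖ ≤ m := Real.le_sqrt_of_sq_le (hPle x)
    have h2 : ‖x‖ ≤ (C + 1) * m := by nlinarith
    calc ‖x‖ * ‖x‖ ≤ ((C + 1) * m) * ((C + 1) * m) := by gcongr
      _ = (C + 1) ^ 2 * (m * m) := by ring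
      _ = ‖x‖ * ((C + 1) ^ 2 * ‖B x‖) := by
        rw [hm, Real.mul_self_sqrt (by positivity)]; ring
  have hinj : ∀ x, B x = 0 → x = 0 := fun x hx => by
    have := hlow x
    rw [hx, norm_zero, mul_zero] at this
    exact norm_le_zero_iff.1 this
  have hcl : IsClosed (Set.range B) := B.isClosed_range_of_norm_le hlow
  -- B is symmetric, so a vector orthogonal to its range lies in its kernel, which is zero.
  have htop : B.range = ⊤ := by
    refine eq_top_of_orthogonal_eq_zero hξ hcl ?_ fun y hy => hinj y ?_
    · rintro a _ ⟨x, rfl⟩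
      refine ⟨a • x, ?_⟩
      change T.adjoint (T (a • x)) + P (a • x) = a • B x
      rw [T.map_smul_algebra, T.adjoint.map_smul_algebra, P.map_smul_algebra]
      exact ((smulCLM E a).map_add _ _).symm
    · refine ext_inner_right (compactAlgebra H) fun z => ?_
      rw [← hBsymm, CStarModule.inner_zero_right]
      exact hy _ ⟨z, rfl⟩
  exact ⟨(injective_iff_map_eq_zero B).2 hinj, LinearMap.range_eq_top.1 htop⟩

end CompactModule

theorem theorem3p7 {H : Type*} [NormedAddCommGroup H] [InnerProductSpace ℂ H] [CompleteSpace H]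
    {E : Type*} [NormedAddCommGroup E] [NormedSpace ℂ E] [CompleteSpace E]
    [SMul (compactAlgebra H) E] [CStarModule (compactAlgebra H) E]
    (T : AdjointableOp (compactAlgebra H) E) :
    T.IsFredholm ↔
      IsClosed (Set.range T) ∧
      orthonormalDim (compactAlgebra H) (LinearMap.ker T.toLinearMap) < ⊤ ∧
      orthonormalDim (compactAlgebra H) (LinearMap.ker T.adjoint.toLinearMap) < ⊤ := by
  -- When H = 0 there is no unit vector ξ, but then 𝒦 = 0 forces E = 0.
  rcases subsingleton_or_nontrivial H with hH | hH
  · have hE : Subsingleton E := subsingleton_of_forall_eq 0 fun x =>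
      (CStarModule.inner_self (A := compactAlgebra H)).1
        (Subtype.ext (ContinuousLinearMap.ext fun _ => Subsingleton.elim _ _))
    have hdim : ∀ X : Submodule ℂ E, orthonormalDim (compactAlgebra H) X < ⊤ := fun X => by
      refine (iInf₂_le ∅ ⟨Set.empty_subset _, ⟨by simp, by simp⟩, fun x _ => ?_⟩).trans_lt
        (by simp)
      rw [Subsingleton.elim x 0]
      exact subset_closure (zero_mem _)
    refine ⟨fun _ => ⟨Set.subsingleton_of_subsingleton.isClosed, hdim _, hdim _⟩, fun _ => ?_⟩
    refine ⟨⟨T, ?_⟩, ⟨T, ?_⟩⟩ <;>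
    · rw [Subsingleton.elim (_ - _) (0 : E →L[ℂ] E)]
      exact zero_mem _
  · obtain ⟨ξ, hξ⟩ := exists_norm_eq H zero_le_one
    constructor
    · rintro ⟨⟨S₁, h₁⟩, ⟨S₂, h₂⟩⟩
      exact ⟨isClosed_range_of_parametrix hξ h₁, orthonormalDim_ker_lt_top hξ h₁,
        orthonormalDim_ker_lt_top hξ (adjoint_comp_adjoint_sub_id_mem h₂)⟩
    · rintro ⟨hcl, hd, hd'⟩
      obtain ⟨P, hPsymm, hTP, hPid, hPK⟩ := exists_projection_of_finite_basis (smul_mem_ker T) hd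
      obtain ⟨Q, hQsymm, hTQ, hQid, hQK⟩ :=
        exists_projection_of_finite_basis (smul_mem_ker T.adjoint) hd'
      exact isFredholm_of_bijective hPsymm hTP hPid hPK hQsymm hTQ hQid hQK
        (bijective_adjoint_mul_self_add hξ hcl hPsymm hTP hPid)
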